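/- Regard $\mathbb{RP}^n$ as a subset of $\mathbb{CP}^n$ in the canonical way. A totally real (resp. complex) projective variety is the zero locus in $\mathbb{RP}^n$ (resp. $\mathbb{CP}^n$) of some set of real (resp. complex) homogeneous polynomials in $n+1$ variables. It is irreducible if it is nonempty and is not the union of two projective varieties both different from it. The cone of a subset of projective space consists of $0$ and all vectors representing its points. The dimension of a projective variety is the maximal length of a chain of prime ideals in the quotient of the polynomial ring by the ideal of the polynomials vanishing on its cone, minus $1$. For $X\subseteq\mathbb{RP}^n$, let $I^{\mathbb C}(X)\subseteq\mathbb C[z_0,\dots,z_n]$ be the ideal generated by the complex homogeneous polynomials that vanish on the real cone of $X$, and let $ZI(X)\subseteq\mathbb{CP}^n$ be the zero locus of $I^{\mathbb C}(X)$ (the complexification of $X$). Let $X\subseteq\mathbb{RP}^n$ be a totally real projective variety. (1) If $Y\subseteq X$ is a totally real projective variety, then $ZI(Y)\cap X=Y$. (2) If $Y\subseteq X$ is an irreducible totally real projective variety of dimension $p$, then $ZI(Y)$ is an irreducible complex projective variety of dimension $p$ contained in $ZI(X)$. (3) If $V\subseteq ZI(X)$ is an irreducible complex projective variety of dimension $p$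 and $\dim_{\mathbb R}(V\cap X)=p$, then $V\cap X$ is an irreducible totally real projective variety and $ZI(V\cap X)=V$. (4) Consequently, for every $p\ge 0$, the map $\sum_i n_iY_i\mapsto\sum_i n_i\,ZI(Y_i)$ sends the totally real $p$-cycles on $X$ (formal integral combinations of irreducible $p$-dimensional totally real projective varieties contained in $X$) injectively to $p$-cycles on $ZI(X)$ (formal integral combinations of irreducible $p$-dimensional complex projective varieties contained in $ZI(X)$), and it sends effective cycles (no negative coefficient) to effective cycles. -/

import Mathlib

open scoped LinearAlgebra.Projectivization

noncomputable section

namespace TotallyReal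

/-- Projective `n`-space over the field `k`, as the set of lines in `k ^ (n + 1)`. -/
abbrev PSpace (k : Type*) [Field k] (n : ℕ) : Type _ := ℙ k (Fin (n + 1) → k)

section Field

variable {k : Type*} [Field k] {n : ℕ}

/-- The common zeros in projective space of a set `S` of polynomials: the points all of whose
homogeneous coordinate vectors are zeros of every member of `S`. It is used only for sets of
homogeneous polynomials and for homogeneous ideals. -/
def projZeroLocus (S : Set (MvPolynomial (Fin (n + 1)) k)) : Set (PSpace k n) :=
  {x | ∀ f ∈ S, ∀ (v : Fin (n + 1) → k) (hv : v ≠ 0),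
    Projectivization.mk k v hv = x → MvPolynomial.eval v f = 0}

/-- A projective variety: the zero locus of some homogeneous polynomials. It may be reducible
or empty. For `k = ℝ` these are the totally real projective varieties. -/
def IsProjVariety (X : Set (PSpace k n)) : Prop :=
  ∃ S : Set (MvPolynomial (Fin (n + 1)) k),
    (∀ f ∈ S, ∃ d : ℕ, f.IsHomogeneous d) ∧ X = projZeroLocus S

/-- An irreducible projective variety: nonempty, and not the union of two projective varieties
that are both different from it. -/
def IsIrredProjVariety (X : Set (PSpace k n)) : Prop :=
  IsProjVariety X ∧ X.Nonempty ∧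
    ∀ A B : Set (PSpace k n), IsProjVariety A → IsProjVariety B → X = A ∪ B → X = A ∨ X = B

/-- The cone over a subset of projective space: all the vectors on its lines, and `0`. -/
def cone (X : Set (PSpace k n)) : Set (Fin (n + 1) → k) :=
  {v | ∃ hv : v ≠ 0, Projectivization.mk k v hv ∈ X} ∪ {0}

/-- The dimension of a subset of affine space: the maximal length of a chain of prime ideals in
the ring of polynomials modulo those that vanish on the set. -/
def affineDim {m : ℕ} (V : Set (Fin m → k)) : WithBot ℕ∞ :=
  ringKrullDim (MvPolynomial (Fin m) k ⧸ MvPolynomial.vanishingIdeal k V)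

/-- `X` has projective dimension `p`: the dimension of its cone minus `1` is `p`. -/
def HasProjDim (X : Set (PSpace k n)) (p : ℕ) : Prop :=
  affineDim (cone X) = (p : WithBot ℕ∞) + 1

/-- The ideal generated by the homogeneous polynomials that vanish on a set of vectors. -/
def homogIdeal (C : Set (Fin (n + 1) → k)) : Ideal (MvPolynomial (Fin (n + 1)) k) :=
  Ideal.span {f | (∃ d : ℕ, f.IsHomogeneous d) ∧ ∀ v ∈ C, MvPolynomial.eval v f = 0}

/-- The irreducible `p`-dimensional projective subvarieties of `X`. -/
def irredSubvarieties (X : Set (PSpace k n)) (p : ℕ) : Set (Set (PSpace k n)) :=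
  {Y | Y ⊆ X ∧ IsIrredProjVariety Y ∧ HasProjDim Y p}

/-- The `p`-cycles on `X`: the formal integral combinations of irreducible `p`-dimensional
projective subvarieties of `X`. -/
def cycles (X : Set (PSpace k n)) (p : ℕ) : Submodule ℤ (Set (PSpace k n) →₀ ℤ) :=
  Finsupp.supported ℤ ℤ (irredSubvarieties X p)

end Field

section Complexification

variable {n : ℕ}

/-- The canonical inclusion of `ℝ ^ (n + 1)` in `ℂ ^ (n + 1)`. -/
def ofRealVec (n : ℕ) : (Fin (n + 1) → ℝ) →ₛₗ[Complex.ofRealHom] (Fin (n + 1) → ℂ) where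
  toFun v := fun i => (v i : ℂ)
  map_add' v w := by ext i; simp
  map_smul' a v := by ext i; simp

theorem ofRealVec_injective (n : ℕ) : Function.Injective (ofRealVec n) := by
  intro v w h
  ext i
  exact Complex.ofReal_injective (congrFun h i)

/-- The canonical embedding of real projective space in complex projective space. -/
def realPoints (n : ℕ) : PSpace ℝ n → PSpace ℂ n :=
  Projectivization.map (ofRealVec n) (ofRealVec_injective n)

/-- The ideal generated by the complex homogeneous polynomials that vanish on the real cone of
`X`, regarded as a subset of `ℂ ^ (n + 1)`. -/
def complexIdeal (X : Set (PSpace ℝ n)) : Ideal (MvPolynomial (Fin (n + 1)) ℂ) :=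
  homogIdeal (ofRealVec n '' cone X)

/-- The complexification `ZI(X)`: the complex projective variety defined by `complexIdeal X`. -/
def ZI (X : Set (PSpace ℝ n)) : Set (PSpace ℂ n) :=
  projZeroLocus (complexIdeal X : Set (MvPolynomial (Fin (n + 1)) ℂ))

/-- The complexification of cycles, `∑ nᵢ Yᵢ ↦ ∑ nᵢ ZI(Yᵢ)`. -/
def complexifyCycle (n : ℕ) : (Set (PSpace ℝ n) →₀ ℤ) →ₗ[ℤ] (Set (PSpace ℂ n) →₀ ℤ) :=
  Finsupp.lmapDomain ℤ ℤ (ZI (n := n))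

end Complexification

end TotallyReal

end

/-! Everything is translated into vanishing ideals of cones. A complex polynomial is `a + i b` with
`a`, `b` real, and at a real vector it vanishes iff `a` and `b` both do. Hence `complexIdeal X`
consists of the `a + i b` with `a`, `b` in the real ideal of `X`; it contracts to that ideal, and it
is the full ideal of the cone of `ZI X` (`vanishingIdeal_cone_ZI`). Contraction gives (1) through
`preimage_ZI`. For (2), irreducibility is primality of the ideal (`isIrredProjVariety_iff`), and
primality passes between the two ideals because sums of real squares vanish only termwise
(`isPrime_complexIdeal_iff`). Dimension is preserved because the complex coordinate ring is an
injective integral extension of the real one (`affineDim_cone_ZI`). For (3), the prime ideal of `V`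
lies in the complex ideal of `V ∩ X`; equal finite dimensions of the quotients force equality. Part
(4) is (2) together with injectivity of `ZI` on varieties, which follows from (1). -/

open MvPolynomial in
theorem MvPolynomial.IsHomogeneous.eval_smul {k σ : Type*} [CommSemiring k] {f : MvPolynomial σ k}
    {d : ℕ} (hf : f.IsHomogeneous d) (t : k) (v : σ → k) :
    eval (t • v) f = t ^ d * eval v f := by
  rw [eval_eq, eval_eq, Finset.mul_sum]
  refine Finset.sum_congr rfl fun m hm => ?_
  have hd : ∑ i ∈ m.support, m i = d := by
    have h := hf (mem_support_iff.1 hm)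
    simpa [Finsupp.weight_apply, Finsupp.sum] using h
  simp only [Pi.smul_apply, smul_eq_mul, mul_pow, Finset.prod_mul_distrib,
    Finset.prod_pow_eq_pow_sum, hd]
  ring

/-- An injective integral extension preserves the Krull dimension. -/
theorem ringKrullDim_eq_of_isIntegral (R S : Type*) [CommRing R] [CommRing S] [Algebra R S]
    [Algebra.IsIntegral R S] [FaithfulSMul R S] : ringKrullDim S = ringKrullDim R := by
  -- Incomparability makes contraction strictly monotone; for the other inequality, going up lifts a
  -- chain from a prime lying over its head.
  refine le_antisymm (Order.krullDim_le_of_strictMono (PrimeSpectrum.comap (algebraMap R S))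
    fun P Q h => Ideal.IsIntegral.comap_lt_comap (R := R) (I := P.asIdeal) (J := Q.asIdeal) h) ?_
  refine iSup_le fun l => ?_
  obtain ⟨P⟩ := Ideal.nonempty_primesOver (S := S) (RelSeries.head l).asIdeal
  have := P.2.1
  have := P.2.2
  obtain ⟨L, hL, -⟩ := Ideal.exists_ltSeries_of_hasGoingUp l P.1
  rw [← hL]
  exact le_iSup (fun L : LTSeries (PrimeSpectrum S) => (L.length : WithBot ℕ∞)) L

/-- If `P ≤ J` with `P` prime and the quotients by `P` and `J` have the same finite dimension,
then `P = J`. -/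
theorem Ideal.eq_of_le_of_ringKrullDim_quotient_eq {R : Type*} [CommRing R] {P J : Ideal R}
    [P.IsPrime] (hPJ : P ≤ J) {d : ℕ} (hP : ringKrullDim (R ⧸ P) = d)
    (hJ : ringKrullDim (R ⧸ J) = d) : P = J := by
  refine le_antisymm hPJ fun f hf => ?_
  by_contra hfP
  -- A nonzero element of the domain `R ⧸ P` is a nonzerodivisor, so killing it lowers the dimension
  -- by at least one.
  have h := ringKrullDim_succ_le_of_surjective (Ideal.Quotient.factor hPJ)
    (Ideal.Quotient.factor_surjective hPJ) (r := Ideal.Quotient.mk P f)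
    (mem_nonZeroDivisors_of_ne_zero (by rwa [Ne, Ideal.Quotient.eq_zero_iff_mem]))
    (by rwa [Ideal.Quotient.factor_mk, Ideal.Quotient.eq_zero_iff_mem])
  rw [hP, hJ] at h
  have h' : d + 1 ≤ d := by exact_mod_cast h
  omega

namespace TotallyReal

open MvPolynomial

/-! ### Cones, vanishing ideals and irreducibility over a field -/

section Field

variable {k : Type*} [Field k] {n : ℕ}

theorem mem_vanishingIdeal {m : ℕ} {C : Set (Fin m → k)} {f : MvPolynomial (Fin m) k} :
    f ∈ vanishingIdeal k C ↔ ∀ v ∈ C, eval v f = 0 := by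
  simp [mem_vanishingIdeal_iff, aeval_eq_eval]

/-- The homogeneous components of a polynomial vanish wherever the polynomial does, on a set that
is stable under infinitely many scalars. -/
theorem homogeneousComponent_mem_vanishingIdeal {m : ℕ} {C : Set (Fin m → k)} {T : Set k}
    (hT : T.Infinite) (hC : ∀ t ∈ T, ∀ v ∈ C, t • v ∈ C) {f : MvPolynomial (Fin m) k}
    (hf : f ∈ vanishingIdeal k C) (d : ℕ) : homogeneousComponent d f ∈ vanishingIdeal k C := by
  rw [mem_vanishingIdeal] at hf ⊢
  intro v hv
  -- `q` is `t ↦ f (t • v)` as a polynomial in `t`; its coefficients are the values at `v` of the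
  -- homogeneous components.
  let q : Polynomial k := ∑ i ∈ Finset.range (f.totalDegree + 1),
    Polynomial.monomial i (eval v (homogeneousComponent i f))
  have hq : q = 0 := by
    refine Polynomial.eq_zero_of_infinite_isRoot q (hT.mono fun t ht => ?_)
    have h := hf _ (hC t ht v hv)
    rw [← sum_homogeneousComponent f, map_sum] at h
    simp only [(homogeneousComponent_isHomogeneous _ f).eval_smul] at h
    simpa [q, Polynomial.eval_finsetSum, mul_comm] using h
  by_cases hd : d < f.totalDegree + 1
  · have h := congrArg (fun r => Polynomial.coeff r d) hq
    simpa [q, Polynomial.finsetSum_coeff, Polynomial.coeff_monomial, Finset.sum_ite_eq', hd]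
      using h
  · rw [homogeneousComponent_eq_zero _ _ (by omega), map_zero]

/-- The scalars range over a subset `T` because a real cone inside complex space is stable only
under real scalars. -/
theorem homogIdeal_eq_vanishingIdeal {C : Set (Fin (n + 1) → k)} {T : Set k}
    (hT : T.Infinite) (hC : ∀ t ∈ T, ∀ v ∈ C, t • v ∈ C) :
    homogIdeal C = vanishingIdeal k C := by
  refine le_antisymm (Ideal.span_le.2 fun f hf => mem_vanishingIdeal.2 hf.2) fun f hf => ?_
  rw [← sum_homogeneousComponent f]
  exact Ideal.sum_mem _ fun i _ => Ideal.subset_span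
    ⟨⟨i, homogeneousComponent_isHomogeneous i f⟩,
      mem_vanishingIdeal.1 (homogeneousComponent_mem_vanishingIdeal hT hC hf i)⟩

theorem zero_mem_cone (X : Set (PSpace k n)) : 0 ∈ cone X := Or.inr rfl

theorem mem_cone_iff {X : Set (PSpace k n)} {v : Fin (n + 1) → k} (hv : v ≠ 0) :
    v ∈ cone X ↔ Projectivization.mk k v hv ∈ X := by
  simp [cone, hv]

theorem cone_mono {X Y : Set (PSpace k n)} (h : X ⊆ Y) : cone X ⊆ cone Y := by
  rintro v (⟨hv, hvX⟩ | hv)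
  exacts [Or.inl ⟨hv, h hvX⟩, Or.inr hv]

theorem smul_mem_cone {X : Set (PSpace k n)} (t : k) {v : Fin (n + 1) → k} (hv : v ∈ cone X) :
    t • v ∈ cone X := by
  by_cases h : t • v = 0
  · exact h ▸ zero_mem_cone X
  · have hv0 : v ≠ 0 := fun h0 => h (by rw [h0, smul_zero])
    rw [mem_cone_iff h]
    rw [mem_cone_iff hv0] at hv
    rwa [(Projectivization.mk_eq_mk_iff' k (t • v) v h hv0).2 ⟨t, rfl⟩]

theorem homogIdeal_cone [Infinite k] (X : Set (PSpace k n)) :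
    homogIdeal (cone X) = vanishingIdeal k (cone X) :=
  homogIdeal_eq_vanishingIdeal Set.infinite_univ fun t _ _ hv => smul_mem_cone t hv

theorem projZeroLocus_anti {S T : Set (MvPolynomial (Fin (n + 1)) k)} (h : S ⊆ T) :
    projZeroLocus T ⊆ projZeroLocus S := fun _ hx f hf => hx f (h hf)

theorem mk_mem_projZeroLocus_iff {S : Set (MvPolynomial (Fin (n + 1)) k)}
    (hS : ∀ f ∈ S, ∃ d : ℕ, f.IsHomogeneous d) {v : Fin (n + 1) → k} (hv : v ≠ 0) :
    Projectivization.mk k v hv ∈ projZeroLocus S ↔ ∀ f ∈ S, eval v f = 0 := by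
  refine ⟨fun h f hf => h f hf v hv rfl, fun h f hf w hw hwv => ?_⟩
  obtain ⟨t, rfl⟩ := (Projectivization.mk_eq_mk_iff' k w v hw hv).1 hwv
  obtain ⟨d, hd⟩ := hS f hf
  rw [hd.eval_smul, h f hf, mul_zero]

theorem projZeroLocus_span (S : Set (MvPolynomial (Fin (n + 1)) k)) :
    projZeroLocus (Ideal.span S : Set (MvPolynomial (Fin (n + 1)) k)) = projZeroLocus S := by
  refine Set.Subset.antisymm (projZeroLocus_anti Ideal.subset_span) fun x hx f hf v hv hvx => ?_
  have : Ideal.span S ≤ RingHom.ker (eval v) := Ideal.span_le.2 fun g hg => hx g hg v hv hvx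
  exact this hf

theorem isProjVariety_projZeroLocus_homogIdeal (C : Set (Fin (n + 1) → k)) :
    IsProjVariety (projZeroLocus (homogIdeal C : Set (MvPolynomial (Fin (n + 1)) k))) :=
  ⟨_, fun _ hf => hf.1, projZeroLocus_span _⟩

theorem IsProjVariety.inter {X Y : Set (PSpace k n)} (hX : IsProjVariety X)
    (hY : IsProjVariety Y) : IsProjVariety (X ∩ Y) := by
  obtain ⟨S, hS, rfl⟩ := hX
  obtain ⟨T, hT, rfl⟩ := hY
  refine ⟨S ∪ T, fun f hf => hf.elim (hS f) (hT f), ?_⟩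
  ext x
  exact ⟨fun h f hf => hf.elim (h.1 f) (h.2 f),
    fun h => ⟨fun f hf => h f (Or.inl hf), fun f hf => h f (Or.inr hf)⟩⟩

/-- A variety is cut out by the polynomials that vanish on its cone. -/
theorem IsProjVariety.mk_mem_iff {X : Set (PSpace k n)} (hX : IsProjVariety X)
    {v : Fin (n + 1) → k} (hv : v ≠ 0) :
    Projectivization.mk k v hv ∈ X ↔ ∀ f ∈ vanishingIdeal k (cone X), eval v f = 0 := by
  refine ⟨fun h f hf => mem_vanishingIdeal.1 hf v ((mem_cone_iff hv).2 h), fun h => ?_⟩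
  obtain ⟨S, hS, rfl⟩ := hX
  refine (mk_mem_projZeroLocus_iff hS hv).2 fun f hf => ?_
  -- A nonzero constant in `S` would not vanish at the vertex of the cone. Multiplying by a
  -- coordinate that is nonzero at `v` repairs this and can be cancelled afterwards.
  obtain ⟨i, hi⟩ := Function.ne_iff.1 hv
  have hXf : X i * f ∈ vanishingIdeal k (cone (projZeroLocus S)) := by
    refine mem_vanishingIdeal.2 fun w hw => ?_
    rcases hw with ⟨hw, hwS⟩ | rfl
    · rw [map_mul, hwS f hf w hw rfl, mul_zero]
    · simp
  have h0 := h _ hXf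
  rw [map_mul, eval_X] at h0
  exact (mul_eq_zero.1 h0).resolve_left hi

theorem IsProjVariety.eq_of_vanishingIdeal_eq {X Y : Set (PSpace k n)} (hX : IsProjVariety X)
    (hY : IsProjVariety Y) (h : vanishingIdeal k (cone X) = vanishingIdeal k (cone Y)) :
    X = Y := by
  ext x
  induction x using Projectivization.ind with
  | h v hv => rw [hX.mk_mem_iff hv, hY.mk_mem_iff hv, h]

theorem vanishingIdeal_cone_ne_top (X : Set (PSpace k n)) : vanishingIdeal k (cone X) ≠ ⊤ := by
  intro h
  have := mem_vanishingIdeal.1 (h ▸ Submodule.mem_top : (1 : MvPolynomial _ k) ∈ _) 0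
    (zero_mem_cone X)
  simp at this

/-- A homogeneous polynomial that vanishes on a nonempty set also vanishes at the vertex of
the cone. -/
theorem mem_vanishingIdeal_cone_of_isHomogeneous {X : Set (PSpace k n)} (hX : X.Nonempty)
    {f : MvPolynomial (Fin (n + 1)) k} {d : ℕ} (hf : f.IsHomogeneous d)
    (h : ∀ (v : Fin (n + 1) → k) (hv : v ≠ 0), Projectivization.mk k v hv ∈ X → eval v f = 0) :
    f ∈ vanishingIdeal k (cone X) := by
  refine mem_vanishingIdeal.2 fun v hv => ?_
  rcases hv with ⟨hv, hvX⟩ | rfl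
  · exact h v hv hvX
  · obtain ⟨x, hx⟩ := hX
    have h0 := hf.eval_smul 0 x.rep
    rwa [zero_smul, h x.rep x.rep_nonzero (by rwa [x.mk_rep]), mul_zero] at h0

attribute [local instance] MvPolynomial.gradedAlgebra

theorem isHomogeneous_vanishingIdeal_cone [Infinite k] (X : Set (PSpace k n)) :
    (vanishingIdeal k (cone X)).IsHomogeneous (homogeneousSubmodule (Fin (n + 1)) k) := by
  intro d f hf
  have h := homogeneousComponent_mem_vanishingIdeal (Set.infinite_univ (α := k))
    (fun t _ _ hv => smul_mem_cone t hv) hf d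
  rwa [← decomposition.decompose'_apply] at h

/-- Primality of a homogeneous ideal can be tested on homogeneous `f`, `g`, and `f * g` in the ideal
splits `X` along the zeros of `f` and of `g`. Conversely, a proper decomposition yields two
polynomials outside the ideal whose product lies in it. -/
theorem isIrredProjVariety_iff [Infinite k] {X : Set (PSpace k n)} :
    IsIrredProjVariety X ↔
      IsProjVariety X ∧ X.Nonempty ∧ (vanishingIdeal k (cone X)).IsPrime := by
  refine and_congr_right fun hX => and_congr_right fun hne =>
    ⟨fun hirr => ?_, fun hP A B hA hB hAB => ?_⟩
  · refine (isHomogeneous_vanishingIdeal_cone X).isPrime_of_homogeneous_mem_or_mem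
      (vanishingIdeal_cone_ne_top X) ?_
    rintro f g ⟨d, hf⟩ ⟨e, hg⟩ hfg
    have key : ∀ {a : MvPolynomial (Fin (n + 1)) k} {c : ℕ}, a.IsHomogeneous c →
        X = X ∩ projZeroLocus {a} → a ∈ vanishingIdeal k (cone X) := fun ha h =>
      mem_vanishingIdeal_cone_of_isHomogeneous hne ha fun v hv hvX =>
        (h.subset hvX).2 _ rfl v hv rfl
    have hvar : ∀ {a : MvPolynomial (Fin (n + 1)) k} {c : ℕ}, a.IsHomogeneous c →
        IsProjVariety (X ∩ projZeroLocus {a}) := fun {a c} ha =>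
      hX.inter ⟨{a}, by rintro _ rfl; exact ⟨c, ha⟩, rfl⟩
    refine (hirr _ _ (hvar hf) (hvar hg) ?_).imp (key hf) (key hg)
    rw [← Set.inter_union_distrib_left]
    refine (Set.inter_eq_left.2 fun x hx => ?_).symm
    induction x using Projectivization.ind with
    | h v hv =>
      have h0 := mem_vanishingIdeal.1 hfg v ((mem_cone_iff hv).2 hx)
      rw [map_mul, mul_eq_zero] at h0
      refine h0.imp (fun h => ?_) fun h => ?_
      · exact (mk_mem_projZeroLocus_iff (by rintro _ rfl; exact ⟨d, hf⟩) hv).2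
          (by rintro _ rfl; exact h)
      · exact (mk_mem_projZeroLocus_iff (by rintro _ rfl; exact ⟨e, hg⟩) hv).2
          (by rintro _ rfl; exact h)
  · by_contra! hcon
    have key : ∀ {D : Set (PSpace k n)}, IsProjVariety D → D ⊆ X → X ≠ D →
        ∃ f ∈ vanishingIdeal k (cone D), f ∉ vanishingIdeal k (cone X) := by
      intro D hD hDX hne'
      by_contra! hle
      exact hne' (hX.eq_of_vanishingIdeal_eq hD
        (le_antisymm (vanishingIdeal_anti_mono (cone_mono hDX)) hle))
    obtain ⟨f, hf, hfX⟩ := key hA (hAB ▸ Set.subset_union_left) hcon.1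
    obtain ⟨g, hg, hgX⟩ := key hB (hAB ▸ Set.subset_union_right) hcon.2
    refine (hP.mem_or_mem (mem_vanishingIdeal.2 fun v hv => ?_ : f * g ∈ _)).elim hfX hgX
    rw [mem_vanishingIdeal] at hf hg
    rw [map_mul]
    rcases hv with ⟨hv, hvX⟩ | rfl
    · rw [hAB] at hvX
      rcases hvX with hvA | hvB
      · rw [hf v ((mem_cone_iff hv).2 hvA), zero_mul]
      · rw [hg v ((mem_cone_iff hv).2 hvB), mul_zero]
    · rw [hf 0 (zero_mem_cone A), zero_mul]

/-- The cone of the empty set is the origin, of dimension `0`, which is never `p + 1` for natural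
`p`. -/
theorem HasProjDim.nonempty {X : Set (PSpace k n)} {p : ℕ} (h : HasProjDim X p) :
    X.Nonempty := by
  by_contra hX
  rw [Set.not_nonempty_iff_eq_empty] at hX
  have hc : cone X = {0} := by simp [cone, hX]
  have h0 : affineDim (cone X) = 0 := by
    rw [affineDim, hc]
    let := Ideal.Quotient.field (vanishingIdeal k ({0} : Set (Fin (n + 1) → k)))
    exact ringKrullDim_eq_zero_of_field _
  rw [HasProjDim, h0] at h
  have : (0 : ℕ) = p + 1 := by exact_mod_cast h
  omega

end Field

/-! ### Real and imaginary parts, and complexification -/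

section Complexification

variable {n : ℕ}

theorem exists_re_add_im {σ : Type*} (f : MvPolynomial σ ℂ) : ∃ a b : MvPolynomial σ ℝ,
    f = map Complex.ofRealHom a + C Complex.I * map Complex.ofRealHom b := by
  induction f using MvPolynomial.induction_on with
  | C z =>
    refine ⟨C z.re, C z.im, ?_⟩
    rw [map_C, map_C, ← C_mul, ← C_add]
    congr 1
    simpa [mul_comm] using (Complex.re_add_im z).symm
  | add f g hf hg =>
    obtain ⟨a, b, rfl⟩ := hf
    obtain ⟨c, d, rfl⟩ := hg
    exact ⟨a + c, b + d, by simp only [map_add]; ring⟩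
  | mul_X f i hf =>
    obtain ⟨a, b, rfl⟩ := hf
    exact ⟨a * X i, b * X i, by simp only [map_mul, map_X]; ring⟩

theorem eval_ofRealVec_map (v : Fin (n + 1) → ℝ) (f : MvPolynomial (Fin (n + 1)) ℝ) :
    eval (ofRealVec n v) (map Complex.ofRealHom f) = (eval v f : ℂ) := by
  rw [eval_map]
  exact eval₂_comp_left Complex.ofRealHom (RingHom.id ℝ) v f |>.symm

theorem eval_ofRealVec_eq_zero_iff (v : Fin (n + 1) → ℝ) (a b : MvPolynomial (Fin (n + 1)) ℝ) :
    eval (ofRealVec n v) (map Complex.ofRealHom a + C Complex.I * map Complex.ofRealHom b) = 0 ↔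
      eval v a = 0 ∧ eval v b = 0 := by
  rw [map_add, map_mul, eval_C, eval_ofRealVec_map, eval_ofRealVec_map, Complex.ext_iff]
  simp

theorem complexIdeal_eq_vanishingIdeal (X : Set (PSpace ℝ n)) :
    complexIdeal X = vanishingIdeal ℂ (ofRealVec n '' cone X) := by
  refine homogIdeal_eq_vanishingIdeal
    (Set.infinite_range_of_injective Complex.ofReal_injective) ?_
  rintro _ ⟨t, rfl⟩ _ ⟨v, hv, rfl⟩
  exact ⟨t • v, smul_mem_cone t hv, (ofRealVec n).map_smulₛₗ t v⟩

theorem mem_complexIdeal_iff {X : Set (PSpace ℝ n)} {f : MvPolynomial (Fin (n + 1)) ℂ} :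
    f ∈ complexIdeal X ↔ ∀ v ∈ cone X, eval (ofRealVec n v) f = 0 := by
  rw [complexIdeal_eq_vanishingIdeal, mem_vanishingIdeal, Set.forall_mem_image]

theorem re_add_im_mem_complexIdeal_iff {X : Set (PSpace ℝ n)}
    {a b : MvPolynomial (Fin (n + 1)) ℝ} :
    map Complex.ofRealHom a + C Complex.I * map Complex.ofRealHom b ∈ complexIdeal X ↔
      a ∈ vanishingIdeal ℝ (cone X) ∧ b ∈ vanishingIdeal ℝ (cone X) := by
  simp only [mem_complexIdeal_iff, eval_ofRealVec_eq_zero_iff, mem_vanishingIdeal]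
  exact ⟨fun h => ⟨fun v hv => (h v hv).1, fun v hv => (h v hv).2⟩,
    fun h v hv => ⟨h.1 v hv, h.2 v hv⟩⟩

theorem map_mem_complexIdeal_iff {X : Set (PSpace ℝ n)} {f : MvPolynomial (Fin (n + 1)) ℝ} :
    map Complex.ofRealHom f ∈ complexIdeal X ↔ f ∈ vanishingIdeal ℝ (cone X) := by
  simpa using re_add_im_mem_complexIdeal_iff (X := X) (a := f) (b := 0)

theorem ofRealVec_ne_zero {v : Fin (n + 1) → ℝ} (hv : v ≠ 0) : ofRealVec n v ≠ 0 :=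
  fun h => hv (ofRealVec_injective n (h.trans (map_zero _).symm))

theorem realPoints_mk {v : Fin (n + 1) → ℝ} (hv : v ≠ 0) :
    realPoints n (Projectivization.mk ℝ v hv) =
      Projectivization.mk ℂ (ofRealVec n v) (ofRealVec_ne_zero hv) :=
  Projectivization.map_mk _ _ _ _

theorem isProjVariety_ZI (X : Set (PSpace ℝ n)) : IsProjVariety (ZI X) :=
  isProjVariety_projZeroLocus_homogIdeal _

theorem ZI_mono {X Y : Set (PSpace ℝ n)} (h : X ⊆ Y) : ZI X ⊆ ZI Y :=
  projZeroLocus_anti fun _ hf =>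
    mem_complexIdeal_iff.2 fun v hv => mem_complexIdeal_iff.1 hf v (cone_mono h hv)

theorem realPoints_mem_ZI {X : Set (PSpace ℝ n)} {x : PSpace ℝ n} (hx : x ∈ X) :
    realPoints n x ∈ ZI X := by
  induction x using Projectivization.ind with
  | h v hv =>
    rw [realPoints_mk, ZI, complexIdeal, homogIdeal, projZeroLocus_span,
      mk_mem_projZeroLocus_iff fun _ hf => hf.1]
    exact fun f hf => hf.2 _ ⟨v, (mem_cone_iff hv).2 hx, rfl⟩

/-- The real cone is Zariski dense in the cone of the complexification. -/
theorem vanishingIdeal_cone_ZI (X : Set (PSpace ℝ n)) :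
    vanishingIdeal ℂ (cone (ZI X)) = complexIdeal X := by
  refine le_antisymm (fun f hf => mem_complexIdeal_iff.2 fun v hv => ?_) fun f hf =>
    mem_vanishingIdeal.2 fun v hv => ?_
  · refine mem_vanishingIdeal.1 hf _ ?_
    rcases hv with ⟨hv, hvX⟩ | rfl
    · rw [mem_cone_iff (ofRealVec_ne_zero hv), ← realPoints_mk hv]
      exact realPoints_mem_ZI hvX
    · rw [map_zero]
      exact zero_mem_cone _
  · rcases hv with ⟨hv, hvX⟩ | rfl
    · exact hvX f hf v hv rfl
    · simpa using mem_complexIdeal_iff.1 hf 0 (zero_mem_cone X)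

theorem preimage_ZI {Y : Set (PSpace ℝ n)} (hY : IsProjVariety Y) :
    realPoints n ⁻¹' ZI Y = Y := by
  refine Set.Subset.antisymm (fun x hx => ?_) fun x hx => realPoints_mem_ZI hx
  induction x using Projectivization.ind with
  | h v hv =>
    rw [Set.mem_preimage, realPoints_mk, (isProjVariety_ZI Y).mk_mem_iff,
      vanishingIdeal_cone_ZI] at hx
    refine (hY.mk_mem_iff hv).2 fun f hf => ?_
    have h := hx _ (map_mem_complexIdeal_iff.2 hf)
    rw [eval_ofRealVec_map] at h
    exact_mod_cast h

theorem vanishingIdeal_le_complexIdeal (V : Set (PSpace ℂ n)) (X : Set (PSpace ℝ n)) :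
    vanishingIdeal ℂ (cone V) ≤ complexIdeal (realPoints n ⁻¹' V ∩ X) := by
  refine fun f hf => mem_complexIdeal_iff.2 fun w hw => mem_vanishingIdeal.1 hf _ ?_
  rcases hw with ⟨hw, hwW⟩ | rfl
  · rw [mem_cone_iff (ofRealVec_ne_zero hw), ← realPoints_mk hw]
    exact hwW.1
  · rw [map_zero]
    exact zero_mem_cone _

/-- A complex variety meets a totally real variety in a totally real variety. -/
theorem IsProjVariety.preimage_inter {V : Set (PSpace ℂ n)} (hV : IsProjVariety V)
    {X : Set (PSpace ℝ n)} (hX : IsProjVariety X) :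
    IsProjVariety (realPoints n ⁻¹' V ∩ X) := by
  set W := realPoints n ⁻¹' V ∩ X with hW
  suffices h : W = projZeroLocus (homogIdeal (cone W) : Set (MvPolynomial (Fin (n + 1)) ℝ)) by
    rw [h]
    exact isProjVariety_projZeroLocus_homogIdeal _
  rw [homogIdeal_cone]
  refine Set.Subset.antisymm (fun x hx f hf v hv hvx => mem_vanishingIdeal.1 hf v
    ((mem_cone_iff hv).2 (hvx ▸ hx))) fun x hx => ?_
  induction x using Projectivization.ind with
  | h v hv =>
    have hv0 : ∀ f ∈ vanishingIdeal ℝ (cone W), eval v f = 0 := fun f hf => hx f hf v hv rfl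
    refine ⟨?_, (hX.mk_mem_iff hv).2 fun f hf =>
      hv0 f (vanishingIdeal_anti_mono (cone_mono Set.inter_subset_right) hf)⟩
    rw [Set.mem_preimage, realPoints_mk, hV.mk_mem_iff]
    intro f hf
    have hfW := vanishingIdeal_le_complexIdeal V X hf
    obtain ⟨a, b, rfl⟩ := exists_re_add_im f
    rw [re_add_im_mem_complexIdeal_iff] at hfW
    exact (eval_ofRealVec_eq_zero_iff v a b).2 ⟨hv0 a hfW.1, hv0 b hfW.2⟩

/-- One direction is contraction of a prime. For the other, `a + i b` is replaced by its norm `a ^ 2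
+ b ^ 2`, a real polynomial with the same real zeros. -/
theorem isPrime_complexIdeal_iff {X : Set (PSpace ℝ n)} :
    (complexIdeal X).IsPrime ↔ (vanishingIdeal ℝ (cone X)).IsPrime := by
  refine ⟨fun h => ?_, fun h => ⟨?_, fun {f g} hfg => ?_⟩⟩
  · have : vanishingIdeal ℝ (cone X) = (complexIdeal X).comap (map Complex.ofRealHom) := by
      ext f
      exact map_mem_complexIdeal_iff.symm
    rw [this]
    exact h.comap _
  · rw [← vanishingIdeal_cone_ZI]
    exact vanishingIdeal_cone_ne_top _
  · obtain ⟨a, b, rfl⟩ := exists_re_add_im f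
    obtain ⟨c, d, rfl⟩ := exists_re_add_im g
    have sq : ∀ {r s : MvPolynomial (Fin (n + 1)) ℝ},
        r ^ 2 + s ^ 2 ∈ vanishingIdeal ℝ (cone X) →
        r ∈ vanishingIdeal ℝ (cone X) ∧ s ∈ vanishingIdeal ℝ (cone X) := by
      intro r s hrs
      have h0 : ∀ v ∈ cone X, eval v r = 0 ∧ eval v s = 0 := fun v hv => by
        have := mem_vanishingIdeal.1 hrs v hv
        rw [map_add, map_pow, map_pow] at this
        constructor <;> nlinarith [sq_nonneg (eval v r), sq_nonneg (eval v s)]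
      exact ⟨mem_vanishingIdeal.2 fun v hv => (h0 v hv).1,
        mem_vanishingIdeal.2 fun v hv => (h0 v hv).2⟩
    simp only [re_add_im_mem_complexIdeal_iff]
    refine (h.mem_or_mem (mem_vanishingIdeal.2 fun v hv => ?_ :
      (a ^ 2 + b ^ 2) * (c ^ 2 + d ^ 2) ∈ _)).imp sq sq
    have h0 := mem_complexIdeal_iff.1 hfg v hv
    rw [map_mul, mul_eq_zero, eval_ofRealVec_eq_zero_iff, eval_ofRealVec_eq_zero_iff] at h0
    rcases h0 with ⟨h1, h2⟩ | ⟨h1, h2⟩ <;> simp [h1, h2]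

-- Invariance of dimension, and the recovery of `V` from its real points

attribute [local instance] MvPolynomial.algebraMvPolynomial

instance isIntegral_mvPolynomial_complex (σ : Type*) :
    Algebra.IsIntegral (MvPolynomial σ ℝ) (MvPolynomial σ ℂ) := by
  refine ⟨fun f => ?_⟩
  obtain ⟨a, b, rfl⟩ := exists_re_add_im f
  have hI : IsIntegral (MvPolynomial σ ℝ) (C Complex.I : MvPolynomial σ ℂ) := by
    refine IsIntegral.of_pow (n := 2) two_pos ?_
    rw [← C_pow, Complex.I_sq, C_neg, C_1]
    exact isIntegral_one.neg
  exact (isIntegral_algebraMap (x := a)).add (hI.mul (isIntegral_algebraMap (x := b)))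

theorem affineDim_cone_ZI (X : Set (PSpace ℝ n)) :
    affineDim (cone (ZI X)) = affineDim (cone X) := by
  rw [affineDim, affineDim, vanishingIdeal_cone_ZI]
  -- Lying over makes the map of quotient rings injective; it stays integral.
  have : (complexIdeal X).LiesOver (vanishingIdeal ℝ (cone X)) :=
    ⟨by ext f; exact map_mem_complexIdeal_iff.symm⟩
  exact ringKrullDim_eq_of_isIntegral _ _

theorem hasProjDim_ZI_iff {X : Set (PSpace ℝ n)} {p : ℕ} :
    HasProjDim (ZI X) p ↔ HasProjDim X p := by
  rw [HasProjDim, HasProjDim, affineDim_cone_ZI]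

theorem IsIrredProjVariety.ZI {Y : Set (PSpace ℝ n)} (hY : IsIrredProjVariety Y) :
    IsIrredProjVariety (ZI Y) := by
  obtain ⟨-, ⟨y, hy⟩, hP⟩ := isIrredProjVariety_iff.1 hY
  refine isIrredProjVariety_iff.2 ⟨isProjVariety_ZI Y, ⟨_, realPoints_mem_ZI hy⟩, ?_⟩
  rwa [vanishingIdeal_cone_ZI, isPrime_complexIdeal_iff]

theorem isIrredProjVariety_and_ZI_preimage_inter_eq {X : Set (PSpace ℝ n)} (hX : IsProjVariety X)
    {V : Set (PSpace ℂ n)} (hV : IsIrredProjVariety V) {p : ℕ} (hVp : HasProjDim V p)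
    (hp : HasProjDim (realPoints n ⁻¹' V ∩ X) p) :
    IsIrredProjVariety (realPoints n ⁻¹' V ∩ X) ∧
      TotallyReal.ZI (realPoints n ⁻¹' V ∩ X) = V := by
  obtain ⟨hVv, -, hP⟩ := isIrredProjVariety_iff.1 hV
  have heq : vanishingIdeal ℂ (cone V) = complexIdeal (realPoints n ⁻¹' V ∩ X) := by
    -- Cones have dimension one more than the projective sets, hence `p + 1`.
    refine Ideal.eq_of_le_of_ringKrullDim_quotient_eq (d := p + 1)
      (vanishingIdeal_le_complexIdeal V X) (by exact_mod_cast hVp) ?_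
    have h := hasProjDim_ZI_iff.2 hp
    rw [HasProjDim, affineDim, vanishingIdeal_cone_ZI] at h
    exact_mod_cast h
  refine ⟨isIrredProjVariety_iff.2 ⟨hVv.preimage_inter hX, hp.nonempty, ?_⟩,
    (isProjVariety_ZI _).eq_of_vanishingIdeal_eq hVv ?_⟩
  · rwa [← isPrime_complexIdeal_iff, ← heq]
  · rw [vanishingIdeal_cone_ZI, heq]

theorem ZI_injOn : Set.InjOn (TotallyReal.ZI (n := n)) {Y | IsProjVariety Y} :=
  fun Y hY Z hZ h => by rw [← preimage_ZI hY, h, preimage_ZI hZ]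

theorem mapsTo_complexifyCycle (X : Set (PSpace ℝ n)) (p : ℕ) :
    Set.MapsTo (complexifyCycle n) (cycles X p) (cycles (TotallyReal.ZI X) p) := by
  classical
  intro c hc Z hZ
  obtain ⟨Y, hY, rfl⟩ := Finset.mem_image.1 (Finsupp.mapDomain_support hZ)
  obtain ⟨hYX, hirr, hdim⟩ := hc hY
  exact ⟨ZI_mono hYX, hirr.ZI, hasProjDim_ZI_iff.2 hdim⟩

theorem injOn_complexifyCycle (X : Set (PSpace ℝ n)) (p : ℕ) :
    Set.InjOn (complexifyCycle n) (cycles X p) :=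
  Finsupp.mapDomain_injOn (irredSubvarieties X p) (ZI_injOn.mono fun _ hY => hY.2.1.1)

end Complexification

end TotallyReal

open TotallyReal in
theorem mainTheorem8 (n : ℕ) (X : Set (PSpace ℝ n)) (hX : IsProjVariety X) :
    -- (1) `ZI(Y) ∩ X = Y`, as subsets of complex projective space
    (∀ Y : Set (PSpace ℝ n), Y ⊆ X → IsProjVariety Y →
      ZI Y ∩ realPoints n '' X = realPoints n '' Y) ∧
    -- (2)
    (∀ (p : ℕ) (Y : Set (PSpace ℝ n)), Y ⊆ X → IsIrredProjVariety Y → HasProjDim Y p →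
      IsIrredProjVariety (ZI Y) ∧ HasProjDim (ZI Y) p ∧ ZI Y ⊆ ZI X) ∧
    -- (3) `V ∩ X`, as a subset of real projective space, is `realPoints n ⁻¹' V ∩ X`
    (∀ (p : ℕ) (V : Set (PSpace ℂ n)), V ⊆ ZI X → IsIrredProjVariety V → HasProjDim V p →
      HasProjDim (realPoints n ⁻¹' V ∩ X) p →
      IsIrredProjVariety (realPoints n ⁻¹' V ∩ X) ∧ ZI (realPoints n ⁻¹' V ∩ X) = V) ∧
    -- (4) complexification embeds totally real cycles into complex cycles
    (∀ p : ℕ,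
      Set.MapsTo (complexifyCycle n) (cycles X p) (cycles (ZI X) p) ∧
      Set.InjOn (complexifyCycle n) (cycles X p) ∧
      ∀ c ∈ cycles X p, 0 ≤ c → 0 ≤ complexifyCycle n c) := by
  refine ⟨fun Y hYX hY => ?_, fun p Y hYX hY hp => ⟨hY.ZI, hasProjDim_ZI_iff.2 hp, ZI_mono hYX⟩,
    fun p V _ hV hVp hp => isIrredProjVariety_and_ZI_preimage_inter_eq hX hV hVp hp,
    fun p => ⟨mapsTo_complexifyCycle X p, injOn_complexifyCycle X p,
      fun c _ hc => Finsupp.mapDomain_nonneg hc⟩⟩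
  rw [← Set.image_preimage_inter, preimage_ZI hY, Set.inter_eq_left.2 hYX]
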